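/- Let $G=\bigoplus_{i=1}^{\infty}\mathbb Z$ be the discrete group of finitely supported integer sequences, and let $\ell^1(G)$ be the Banach algebra of all functions $f\colon G\to\mathbb C$ with $\|f\|=\sum_{s\in G}|f(s)|<\infty$, with convolution $(f*g)(t)=\sum_{s\in G}f(s)\,g(t-s)$ as product. Let $\ell^1(G)''$ be its bidual, regarded as a Banach algebra under the first Arens product $\Box$: for a Banach algebra $A$ and $\Psi,\Phi\in A''$, $\lambda\in A'$, $a,b\in A$, $$\langle\Psi\,\Box\,\Phi,\lambda\rangle=\langle\Psi,\Phi\cdot\lambda\rangle,\qquad \langle\Phi\cdot\lambda,a\rangle=\langle\Phi,\lambda\cdot a\rangle,\qquad \langle\lambda\cdot a,b\rangle=\langle\lambda,ab\rangle .$$ Then the Jacobson radical of $(\ell^1(G)'',\Box)$ contains an element that is not nilpotent: there is $\Phi\in\operatorname{rad}(\ell^1(G)'')$ such that $\Phi^{\Box n}\neq 0$ for every $n\ge 1$. -/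

import Mathlib

open scoped ENNReal

noncomputable section

/-! ### The convolution algebra `ℓ¹(G)` of a discrete group `G` (written additively) -/

/-- `ℓ¹(G)`: the complex functions on `G` with `‖f‖ = ∑ ‖f s‖ < ∞`. -/
abbrev EllOne (G : Type*) : Type _ := lp (fun _ : G => ℂ) 1

namespace EllOne

variable {G : Type*}

theorem summable_norm (f : EllOne G) : Summable fun s => ‖f s‖ := by
  simpa using (lp.memℓp f).summable (by simp)

theorem norm_eq (f : EllOne G) : ‖f‖ = ∑' s, ‖f s‖ := by
  simpa using lp.norm_eq_tsum_rpow (p := 1) (by simp) f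

theorem norm_apply_le (f : EllOne G) (s : G) : ‖f s‖ ≤ ‖f‖ :=
  lp.norm_apply_le_norm one_ne_zero f s

variable [AddGroup G]

/-- The change of variables `(s, t) ↦ (s, -s + t)`. -/
def shear (G : Type*) [AddGroup G] : G × G ≃ G × G where
  toFun p := (p.1, -p.1 + p.2)
  invFun p := (p.1, p.1 + p.2)
  left_inv p := by simp
  right_inv p := by simp

theorem summable_conv (f g : EllOne G) :
    Summable fun p : G × G => ‖f p.1‖ * ‖g (-p.1 + p.2)‖ := by
  have h : Summable fun p : G × G => ‖f p.1‖ * ‖g p.2‖ :=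
    (summable_norm f).mul_of_nonneg (summable_norm g) (fun _ => norm_nonneg _)
      (fun _ => norm_nonneg _)
  exact (shear G).summable_iff.mpr h

theorem summable_conv_apply (f g : EllOne G) (t : G) :
    Summable fun s => ‖f s‖ * ‖g (-s + t)‖ :=
  (summable_conv f g).prod_symm.prod_factor t

theorem summable_conv_apply' (f g : EllOne G) (t : G) :
    Summable fun s => f s * g (-s + t) :=
  .of_norm (by simpa using summable_conv_apply f g t)

theorem summable_conv_tsum (f g : EllOne G) :
    Summable fun t => ∑' s, ‖f s‖ * ‖g (-s + t)‖ :=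
  (summable_conv f g).prod_symm.prod

theorem tsum_conv (f g : EllOne G) :
    ∑' t, ∑' s, ‖f s‖ * ‖g (-s + t)‖ = ‖f‖ * ‖g‖ := by
  have h := (summable_conv f g).prod_symm.tsum_prod
  simp only [Prod.fst_swap, Prod.snd_swap, Prod.swap_prod_mk] at h
  rw [norm_eq, norm_eq, ← h]
  rw [(summable_norm f).tsum_mul_tsum (summable_norm g)
    ((summable_norm f).mul_of_nonneg (summable_norm g) (fun _ => norm_nonneg _)
      (fun _ => norm_nonneg _))]
  exact ((Equiv.prodComm G G).trans (shear G)).tsum_eq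
    (fun p : G × G => ‖f p.1‖ * ‖g p.2‖)

theorem norm_conv_le (f g : EllOne G) (t : G) :
    ‖∑' s, f s * g (-s + t)‖ ≤ ∑' s, ‖f s‖ * ‖g (-s + t)‖ := by
  simpa using norm_tsum_le_tsum_norm (f := fun s => f s * g (-s + t))
    (by simpa using summable_conv_apply f g t)

theorem summable_norm_conv (f g : EllOne G) :
    Summable fun t => ‖∑' s, f s * g (-s + t)‖ :=
  (summable_conv_tsum f g).of_nonneg_of_le (fun _ => norm_nonneg _) (norm_conv_le f g)

/-- Convolution: `(f * g) t = ∑ s, f s * g (-s + t)`. -/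
instance : Mul (EllOne G) where
  mul f g := ⟨fun t => ∑' s, f s * g (-s + t),
    memℓp_gen (by simpa using summable_norm_conv f g)⟩

theorem mul_apply (f g : EllOne G) (t : G) : (f * g) t = ∑' s, f s * g (-s + t) := rfl

open Classical in
/-- The identity is the point mass at the neutral element. -/
instance : One (EllOne G) where
  one := lp.single 1 0 1

open Classical in
theorem one_apply (t : G) : (1 : EllOne G) t = if t = 0 then 1 else 0 := by
  change (lp.single 1 (0 : G) (1 : ℂ) : EllOne G) t = _
  simp [lp.single_apply, Pi.single_apply]

/-- `ℓ¹(G)` with convolution is a normed ring (complete, since `lp` is). -/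
instance : NormedRing (EllOne G) :=
  { (inferInstance : NormedAddCommGroup (EllOne G)),
    (inferInstance : Mul (EllOne G)),
    (inferInstance : One (EllOne G)) with
    left_distrib := fun f g h => by
      ext t
      simp only [mul_apply, lp.coeFn_add, Pi.add_apply, mul_add]
      exact (summable_conv_apply' f g t).tsum_add (summable_conv_apply' f h t)
    right_distrib := fun f g h => by
      ext t
      simp only [mul_apply, lp.coeFn_add, Pi.add_apply, add_mul]
      exact (summable_conv_apply' f h t).tsum_add (summable_conv_apply' g h t)
    zero_mul := fun f => by ext t; simp [mul_apply]
    mul_zero := fun f => by ext t; simp [mul_apply]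
    one_mul := fun f => by
      ext t
      rw [mul_apply, tsum_eq_single 0 (fun s hs => by simp [one_apply, hs])]
      simp [one_apply]
    mul_one := fun f => by
      ext t
      rw [mul_apply, tsum_eq_single t]
      · simp [one_apply]
      · intro s hs
        have : -s + t ≠ 0 := fun h => hs (by rw [neg_add_eq_zero] at h; exact h)
        simp [one_apply, this]
    mul_assoc := fun f g h => by
      ext t
      have hs : Summable fun p : G × G => f p.1 * g (-p.1 + p.2) * h (-p.2 + t) := by
        refine .of_norm_bounded ((summable_conv f g).mul_right ‖h‖) fun p => ?_
        rw [norm_mul, norm_mul]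
        exact mul_le_mul_of_nonneg_left (norm_apply_le h _) (by positivity)
      calc ∑' s, (∑' r, f r * g (-r + s)) * h (-s + t)
          = ∑' s, ∑' r, f r * g (-r + s) * h (-s + t) := by simp_rw [tsum_mul_right]
        _ = ∑' r, ∑' s, f r * g (-r + s) * h (-s + t) :=
            (Summable.tsum_comm (f := fun r s => f r * g (-r + s) * h (-s + t)) hs)
        _ = ∑' r, f r * ∑' u, g u * h (-u + (-r + t)) := by
            refine tsum_congr fun r => ?_
            rw [← tsum_mul_left, ← (Equiv.addLeft (-r)).tsum_eq
              (fun u => f r * (g u * h (-u + (-r + t))))]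
            refine tsum_congr fun s => ?_
            simp [mul_assoc, add_assoc]
    norm_mul_le := fun f g => by
      rw [← tsum_conv, norm_eq]
      exact (summable_norm_conv f g).tsum_le_tsum (norm_conv_le f g) (summable_conv_tsum f g) }

instance : NormedAlgebra ℂ (EllOne G) :=
  { Algebra.ofModule (R := ℂ) (A := EllOne G)
      (fun c f g => by
        ext t
        simp only [mul_apply, lp.coeFn_smul, Pi.smul_apply, smul_eq_mul, mul_assoc,
          tsum_mul_left])
      (fun c f g => by
        ext t
        simp only [mul_apply, lp.coeFn_smul, Pi.smul_apply, smul_eq_mul, mul_left_comm _ c,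
          tsum_mul_left]) with
    norm_smul_le := norm_smul_le }

end EllOne

/-! ### The bidual of a Banach algebra with the first Arens product -/

/-- The bidual `A''`. -/
abbrev Bidual (A : Type*) [NormedRing A] [NormedAlgebra ℂ A] : Type _ :=
  StrongDual ℂ (StrongDual ℂ A)

namespace Bidual

variable {A : Type*} [NormedRing A] [NormedAlgebra ℂ A]

/-- The right action of `A` on `A'`: `⟨l · a, b⟩ = ⟨l, a b⟩`, as a map of `a`. -/
def dualAct (l : StrongDual ℂ A) : A →L[ℂ] StrongDual ℂ A :=
  (ContinuousLinearMap.compL ℂ A A ℂ l).comp (ContinuousLinearMap.mul ℂ A)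

@[simp] theorem dualAct_apply (l : StrongDual ℂ A) (a b : A) : dualAct l a b = l (a * b) := rfl

theorem norm_dualAct_apply_le (l : StrongDual ℂ A) (a : A) : ‖dualAct l a‖ ≤ ‖l‖ * ‖a‖ :=
  ContinuousLinearMap.opNorm_le_bound _ (by positivity) fun b => by
    rw [dualAct_apply, mul_assoc]
    exact (l.le_opNorm _).trans (mul_le_mul_of_nonneg_left (norm_mul_le a b) (norm_nonneg l))

theorem norm_comp_dualAct_le (Φ : Bidual A) (l : StrongDual ℂ A) :
    ‖Φ.comp (dualAct l)‖ ≤ ‖Φ‖ * ‖l‖ :=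
  ContinuousLinearMap.opNorm_le_bound _ (by positivity) fun a => by
    rw [mul_assoc]
    exact (Φ.le_opNorm _).trans
      (mul_le_mul_of_nonneg_left (norm_dualAct_apply_le l a) (norm_nonneg Φ))

/-- The left action of `A''` on `A'`: `⟨Φ · l, a⟩ = ⟨Φ, l · a⟩`, as a map of `l`. -/
def bidualAct (Φ : Bidual A) : StrongDual ℂ A →L[ℂ] StrongDual ℂ A :=
  LinearMap.mkContinuous
    { toFun := fun l => Φ.comp (dualAct l)
      map_add' := fun l m => by
        ext a
        exact map_add Φ (dualAct l a) (dualAct m a)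
      map_smul' := fun c l => by
        ext a
        exact map_smul Φ c (dualAct l a) }
    ‖Φ‖ (norm_comp_dualAct_le Φ)

@[simp] theorem bidualAct_apply (Φ : Bidual A) (l : StrongDual ℂ A) (a : A) :
    bidualAct Φ l a = Φ (dualAct l a) := rfl

/-- The first Arens product: `⟨Ψ □ Φ, l⟩ = ⟨Ψ, Φ · l⟩`. -/
instance : Mul (Bidual A) where
  mul Ψ Φ := Ψ.comp (bidualAct Φ)

theorem mul_apply (Ψ Φ : Bidual A) (l : StrongDual ℂ A) : (Ψ * Φ) l = Ψ (bidualAct Φ l) := rfl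

/-- The identity of `A''` is the image of the identity of `A`. -/
instance : One (Bidual A) where
  one := NormedSpace.inclusionInDoubleDual ℂ A 1

theorem one_apply (l : StrongDual ℂ A) : (1 : Bidual A) l = l 1 := rfl

/-- `A''` with the first Arens product is a normed ring. -/
instance : NormedRing (Bidual A) :=
  { (inferInstance : NormedAddCommGroup (Bidual A)),
    (inferInstance : Mul (Bidual A)),
    (inferInstance : One (Bidual A)) with
    left_distrib := fun Φ Ψ Θ => by
      ext l
      exact map_add Φ (bidualAct Ψ l) (bidualAct Θ l)
    right_distrib := fun Φ Ψ Θ => rfl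
    zero_mul := fun Φ => rfl
    mul_zero := fun Φ => by
      ext l
      exact map_zero Φ
    one_mul := fun Φ => by
      ext l
      rw [mul_apply, one_apply, bidualAct_apply]
      congr 1
      ext b
      simp
    mul_one := fun Φ => by
      ext l
      rw [mul_apply]
      congr 1
      ext b
      simp [one_apply]
    mul_assoc := fun Φ Ψ Θ => by
      ext l
      simp only [mul_apply]
      congr 1
      ext a
      simp only [bidualAct_apply, mul_apply]
      congr 1
      ext b
      simp only [bidualAct_apply, dualAct_apply]
      congr 1
      ext c
      simp [mul_assoc]
    norm_mul_le := fun Ψ Φ =>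
      ContinuousLinearMap.opNorm_le_bound _ (by positivity) fun l => by
        rw [mul_apply, mul_assoc]
        exact (Ψ.le_opNorm _).trans
          (mul_le_mul_of_nonneg_left (norm_comp_dualAct_le Φ l) (norm_nonneg Ψ)) }

instance : NormedAlgebra ℂ (Bidual A) :=
  { Algebra.ofModule (R := ℂ) (A := Bidual A)
      (fun c Φ Ψ => rfl)
      (fun c Φ Ψ => by
        ext l
        exact map_smul Φ c (bidualAct Ψ l)) with
    norm_smul_le := fun c Φ => ContinuousLinearMap.opNorm_smul_le c Φ }

end Bidual

end

/-!
Let `e ∈ G` have infinite order. Weak-* limits `M` and `M'` of the Cesàro means of the point masses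
at `0, e, 2e, …` and at `0, -e, -2e, …` agree on `e`-invariant functionals, so `M - M'` is
`e`-invariant and kills all `e`-invariant functionals; hence it generates a left ideal of square
zero, which lies in the radical. On the other hand, if `φ j e = 0` for all `j ≠ i` and `φ i e > 0`,
then `Ξ i = (M - M') / 2` removes the factor `sign (φ i s)` from the bounded function
`s ↦ ∏ j ∈ S, sign (φ j s)`, and kills that function when `i ∉ S`.

The radical is closed, so for independent `e i` with dual homomorphisms `φ i` it contains
`Φ = ∑' i, 2⁻ⁱ Ξ i`. Its `n`-th power strips the factors of a product of `n` signs in all `n!`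
orders, so it takes the value `n! ∏ 2⁻ⁱ ≠ 0` there.
-/

open Filter Topology

section Jacobson

theorem mem_jacobson_of_forall_mul_mul_eq_zero {R : Type*} [Ring R] {x : R}
    (h : ∀ y, x * y * x = 0) : x ∈ Ring.jacobson R := by
  rw [← Ideal.jacobson_bot, Ideal.mem_jacobson_iff]
  refine fun y => ⟨1 - y * x, ?_⟩
  have hquasi : (1 - y * x) * y * x + (1 - y * x) - 1 = -(y * (x * y * x)) := by noncomm_ring
  rw [hquasi, h, mul_zero, neg_zero]
  exact Ideal.zero_mem _

theorem isClosed_jacobson (R : Type*) [NormedRing R] [CompleteSpace R] :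
    IsClosed (Ring.jacobson R : Set R) := by
  rw [Ring.jacobson_eq_sInf_isMaximal, Submodule.coe_sInf]
  exact isClosed_biInter fun I (hI : Ideal.IsMaximal I) => Ideal.IsMaximal.isClosed

end Jacobson

theorem exists_strongDual_tendsto_of_norm_le {𝕜 E α : Type*} [NontriviallyNormedField 𝕜]
    [ProperSpace 𝕜] [SeminormedAddCommGroup E] [NormedSpace 𝕜 E] (U : Ultrafilter α)
    {u : α → StrongDual 𝕜 E} {C : ℝ} (hu : ∀ n, ‖u n‖ ≤ C) :
    ∃ Φ : StrongDual 𝕜 E, ‖Φ‖ ≤ C ∧ ∀ x, Tendsto (fun n => u n x) U (𝓝 (Φ x)) := by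
  have hball : U.map (fun n => StrongDual.toWeakDual (u n)) ≤
      (𝓟 (WeakDual.toStrongDual ⁻¹' Metric.closedBall (0 : StrongDual 𝕜 E) C) :
        Filter (WeakDual 𝕜 E)) := by
    rw [Ultrafilter.coe_map, le_principal_iff, mem_map]
    exact univ_mem' fun n => by simpa using hu n
  obtain ⟨Φ, hΦ, hlim⟩ := (WeakDual.isCompact_closedBall 0 C).ultrafilter_le_nhds _ hball
  exact ⟨WeakDual.toStrongDual Φ, by simpa using hΦ,
    fun x => ((WeakDual.eval_continuous x).tendsto Φ).comp hlim⟩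

section LinearIndependence

theorem exists_nat_linearIndependent_of_aleph0_le_rank {R M : Type*} [CommRing R] [IsDomain R]
    [AddCommGroup M] [Module R M] (h : Cardinal.aleph0 ≤ Module.rank R M) :
    ∃ e : ℕ → M, LinearIndependent R e := by
  obtain ⟨s, hcard, hs⟩ := exists_set_linearIndependent_of_isDomain R M
  have : Infinite s := Cardinal.infinite_iff.mpr (hcard ▸ h)
  exact ⟨_, hs.linearIndependent.comp _ (Infinite.natEmbedding s).injective⟩

theorem exists_addMonoidHom_apply_eq_of_linearIndependent {ι G Q : Type*} [AddCommGroup G]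
    [AddCommGroup Q] [DivisibleBy Q ℤ] {e : ι → G} (he : LinearIndependent ℤ e) (q : ι → Q) :
    ∃ φ : G →+ Q, ∀ i, φ (e i) = q i := by
  obtain ⟨φ, hφ⟩ := (Module.Baer.of_divisible Q).extension_property
    (Finsupp.linearCombination ℤ e) he (Finsupp.linearCombination ℤ q)
  exact ⟨φ.toAddMonoidHom, fun i => by
    simpa using DFunLike.congr_fun hφ (Finsupp.single i 1)⟩

end LinearIndependence

theorem eventually_sign_add_nsmul_eq {R : Type*} [AddCommGroup R] [LinearOrder R]
    [IsOrderedAddMonoid R] [Archimedean R] (a : R) {c : R} (hc : c ≠ 0) :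
    ∀ᶠ k : ℕ in atTop, SignType.sign (a + k • c) = SignType.sign c := by
  have hpos (b : R) {d : R} (hd : 0 < d) : ∀ᶠ k : ℕ in atTop, 0 < b + k • d :=
    ((tendsto_atTop_add_const_left _ b (tendsto_id.atTop_nsmul_const hd)).eventually_ge_atTop
      d).mono fun _ => hd.trans_le
  rcases hc.lt_or_gt with hneg | hgt
  · filter_upwards [hpos (-a) (neg_pos.mpr hneg)] with k hk
    rw [sign_neg hneg, sign_neg]
    rwa [smul_neg, ← neg_add, neg_pos] at hk
  · filter_upwards [hpos a hgt] with k hk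
    rw [sign_pos hgt, sign_pos hk]

theorem norm_signType_cast_le_one {R : Type*} [NormedRing R] [NormOneClass R] (s : SignType) :
    ‖(s : R)‖ ≤ 1 := by
  cases s <;> simp

noncomputable section

namespace EllOne

variable {G : Type*}

open Classical in
/-- The point mass at `s`. -/
def pointMass (s : G) : EllOne G := lp.single 1 s 1

open Classical in
theorem pointMass_apply (s t : G) : pointMass s t = if t = s then 1 else 0 := by
  simp [pointMass, Pi.single_apply]

theorem norm_pointMass (s : G) : ‖pointMass s‖ = 1 := by
  simp [pointMass, lp.norm_single]

theorem dual_ext {l m : StrongDual ℂ (EllOne G)} (h : ∀ s, l (pointMass s) = m (pointMass s)) :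
    l = m := by
  classical
  refine lp.ext_continuousLinearMap ENNReal.one_ne_top fun s => ?_
  ext
  simpa [pointMass] using h s

/-- The functional on `ℓ¹(G)` given by integration against a bounded function. -/
def ofLInfty (g : lp (fun _ : G => ℂ) ∞) : StrongDual ℂ (EllOne G) :=
  lp.dualPairing ∞ 1 (fun _ => ContinuousLinearMap.mul ℂ ℂ) (K := 1) (fun _ => by simp) g

theorem ofLInfty_pointMass (g : lp (fun _ : G => ℂ) ∞) (s : G) :
    ofLInfty g (pointMass s) = g s := by
  change ∑' t, g t * pointMass s t = g s
  rw [tsum_eq_single s fun t ht => by simp [pointMass_apply, ht]]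
  simp [pointMass_apply]

section AddGroup

variable [AddGroup G]

theorem pointMass_zero : pointMass (0 : G) = 1 := rfl

theorem pointMass_mul_apply (s : G) (f : EllOne G) (t : G) :
    (pointMass s * f) t = f (-s + t) := by
  rw [mul_apply, tsum_eq_single s fun r hr => by simp [pointMass_apply, hr]]
  simp [pointMass_apply]

open Classical in
theorem pointMass_mul_pointMass (s t : G) :
    pointMass s * pointMass t = pointMass (s + t) := by
  ext r
  rw [pointMass_mul_apply, pointMass_apply, pointMass_apply]
  exact if_congr neg_add_eq_iff_eq_add rfl rfl

theorem pointMass_pow (s : G) (k : ℕ) : pointMass s ^ k = pointMass (k • s) := by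
  induction k with
  | zero => rw [pow_zero, zero_nsmul, pointMass_zero]
  | succ k ih => rw [pow_succ, ih, pointMass_mul_pointMass, succ_nsmul]

end AddGroup

protected theorem mul_comm [AddCommGroup G] (f g : EllOne G) : f * g = g * f := by
  ext t
  rw [mul_apply, mul_apply, ← (Equiv.subLeft t).tsum_eq]
  refine tsum_congr fun s => ?_
  rw [Equiv.subLeft_apply, mul_comm, neg_sub, sub_add_cancel, sub_eq_neg_add]

end EllOne

namespace Bidual

variable {A : Type*} [NormedRing A] [NormedAlgebra ℂ A]

section Actions

theorem dualAct_one (l : StrongDual ℂ A) : dualAct l 1 = l := by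
  ext b
  rw [dualAct_apply, one_mul]

theorem dualAct_mul (l : StrongDual ℂ A) (a b : A) :
    dualAct l (a * b) = dualAct (dualAct l a) b := by
  ext c
  simp only [dualAct_apply, mul_assoc]

theorem bidualAct_dualAct (Φ : Bidual A) (l : StrongDual ℂ A) (a : A) :
    bidualAct Φ (dualAct l a) = dualAct (bidualAct Φ l) a := by
  ext b
  rw [dualAct_apply, bidualAct_apply, bidualAct_apply, dualAct_mul]

theorem bidualAct_sub (Φ Ψ : Bidual A) (l : StrongDual ℂ A) :
    bidualAct (Φ - Ψ) l = bidualAct Φ l - bidualAct Ψ l := rfl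

theorem bidualAct_smul (c : ℂ) (Φ : Bidual A) (l : StrongDual ℂ A) :
    bidualAct (c • Φ) l = c • bidualAct Φ l := rfl

theorem bidualAct_tsum {ι : Type*} {Φ : ι → Bidual A} (hΦ : Summable Φ) (l : StrongDual ℂ A) :
    bidualAct (∑' i, Φ i) l = ∑' i, bidualAct (Φ i) l :=
  (ContinuousLinearMap.precomp ℂ (dualAct l)).map_tsum hΦ

end Actions

/-- Such a `Φ` generates a left ideal of square zero: `Ψ · Φ · l` is always `a`-invariant. -/
theorem mem_jacobson_of_invariant {Φ : Bidual A} {a : A} (ha : ∀ b, Commute a b)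
    (hinv : ∀ l, Φ (dualAct l a) = Φ l) (hker : ∀ l, dualAct l a = l → Φ l = 0) :
    Φ ∈ Ring.jacobson (Bidual A) := by
  have hact (l : StrongDual ℂ A) : dualAct (bidualAct Φ l) a = bidualAct Φ l := by
    ext b
    rw [dualAct_apply, bidualAct_apply, bidualAct_apply, (ha b).eq, dualAct_mul, hinv]
  refine mem_jacobson_of_forall_mul_mul_eq_zero fun Ψ => ?_
  ext l
  refine hker (bidualAct Ψ (bidualAct Φ l)) ?_
  rw [← bidualAct_dualAct, hact]

section PowerMean

/-- The Cesàro mean `N⁻¹ (1 + a + ⋯ + a ^ (N - 1))`, equal to `0` for `N = 0`. -/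
def cesaroMean (a : A) (N : ℕ) : A := (N : ℂ)⁻¹ • ∑ k ∈ Finset.range N, a ^ k

theorem norm_cesaroMean_le {a : A} {C : ℝ} (ha : ∀ k : ℕ, ‖a ^ k‖ ≤ C) (N : ℕ) :
    ‖cesaroMean a N‖ ≤ C := by
  have hC : 0 ≤ C := (norm_nonneg _).trans (ha 0)
  have hsum : ‖∑ k ∈ Finset.range N, a ^ k‖ ≤ N * C := by
    simpa using norm_sum_le_of_le (Finset.range N) fun k _ => ha k
  rw [cesaroMean, norm_smul, norm_inv, Complex.norm_natCast]
  exact inv_mul_le_of_le_mul₀ N.cast_nonneg hC hsum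

theorem tendsto_sub_one_mul_cesaroMean {a : A} {C : ℝ} (ha : ∀ k : ℕ, ‖a ^ k‖ ≤ C) :
    Tendsto (fun N => (a - 1) * cesaroMean a N) atTop (𝓝 0) := by
  simp only [cesaroMean, mul_smul_comm, mul_geom_sum]
  refine NormedField.tendsto_zero_smul_of_tendsto_zero_of_bounded
    (tendsto_inv_atTop_nhds_zero_nat (𝕜 := ℂ)) (isBoundedUnder_of ⟨C + ‖(1 : A)‖, fun N => ?_⟩)
  exact norm_sub_le_of_le (ha N) le_rfl

/-- `M` is a generalised limit of the means of the powers of `a`: an `a`-invariant element of the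
bidual that maps `l` to the limit of `l (a ^ k)` whenever this limit exists. -/
structure IsPowerMean (a : A) (M : Bidual A) : Prop where
  apply_dualAct (l : StrongDual ℂ A) : M (dualAct l a) = M l
  apply_eq_of_tendsto {l : StrongDual ℂ A} {c : ℂ}
    (h : Tendsto (fun k : ℕ => l (a ^ k)) atTop (𝓝 c)) : M l = c

theorem exists_isPowerMean {a : A} {C : ℝ} (ha : ∀ k : ℕ, ‖a ^ k‖ ≤ C) :
    ∃ M : Bidual A, ‖M‖ ≤ C ∧ IsPowerMean a M := by
  obtain ⟨M, hnorm, hlim⟩ := exists_strongDual_tendsto_of_norm_le (hyperfilter ℕ)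
    (u := fun N => NormedSpace.inclusionInDoubleDual ℂ A (cesaroMean a N)) fun N =>
      (NormedSpace.double_dual_bound ℂ A _).trans (norm_cesaroMean_le ha N)
  have heq {l : StrongDual ℂ A} {c : ℂ}
      (h : Tendsto (fun N => l (cesaroMean a N)) atTop (𝓝 c)) : M l = c :=
    tendsto_nhds_unique (hlim l) (h.mono_left Nat.hyperfilter_le_atTop)
  refine ⟨M, hnorm, fun l => ?_, fun {l c} h => heq ?_⟩
  · rw [← sub_eq_zero, ← map_sub]
    refine heq (((l.continuous.tendsto' 0 0 (map_zero l)).comp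
      (tendsto_sub_one_mul_cesaroMean ha)).congr fun N => ?_)
    simp [sub_mul]
  · simpa [cesaroMean] using h.cesaro_smul

namespace IsPowerMean

variable {a b : A} {M M' : Bidual A}

theorem apply_eq_apply_one (hM : IsPowerMean a M) {l : StrongDual ℂ A} (hl : dualAct l a = l) :
    M l = l 1 := by
  have hpow (k : ℕ) : l (a ^ k) = l 1 := by
    induction k with
    | zero => rw [pow_zero]
    | succ k ih => rw [pow_succ', ← dualAct_apply, hl, ih]
  exact hM.apply_eq_of_tendsto (by simp only [hpow, tendsto_const_nhds])

theorem sub_mem_jacobson (hM : IsPowerMean a M) (hM' : IsPowerMean b M')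
    (ha : ∀ c, Commute a c) (hab : a * b = 1) : M - M' ∈ Ring.jacobson (Bidual A) := by
  have hcancel (l : StrongDual ℂ A) : dualAct (dualAct l a) b = l := by
    rw [← dualAct_mul, hab, dualAct_one]
  refine mem_jacobson_of_invariant ha (fun l => ?_) fun l hl => ?_
  · rw [sub_apply, sub_apply, hM.apply_dualAct, ← hM'.apply_dualAct (dualAct l a), hcancel]
  · have hlb : dualAct l b = l := by simpa only [hl] using hcancel l
    rw [sub_apply, hM.apply_eq_apply_one hl, hM'.apply_eq_apply_one hlb, sub_self]

end IsPowerMean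

end PowerMean

section Lowering

theorem pow_card_apply_of_bidualAct_eq_sum {ι : Type*} [DecidableEq ι] {Φ : Bidual A}
    {f : Finset ι → StrongDual ℂ A} {w : ι → ℂ}
    (hact : ∀ S, bidualAct Φ (f S) = ∑ i ∈ S, w i • f (S.erase i)) (S : Finset ι) :
    (Φ ^ S.card) (f S) = S.card.factorial * (∏ i ∈ S, w i) * f ∅ 1 := by
  induction hn : S.card generalizing S with
  | zero => simp [Finset.card_eq_zero.mp hn, one_apply]
  | succ n ih =>
    have hterm (i : ι) (hi : i ∈ S) : (Φ ^ n) (w i • f (S.erase i)) =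
        n.factorial * (∏ j ∈ S, w j) * f ∅ 1 := by
      rw [map_smul, ih _ (by rw [Finset.card_erase_of_mem hi, hn, Nat.add_sub_cancel]),
        ← Finset.mul_prod_erase S w hi, smul_eq_mul]
      ring
    rw [pow_succ, mul_apply, hact, map_sum, Finset.sum_congr rfl hterm, Finset.sum_const, hn,
      nsmul_eq_mul, Nat.factorial_succ, Nat.cast_mul]
    ring

theorem exists_mem_jacobson_not_isNilpotent {f : Finset ℕ → StrongDual ℂ A} {Ξ : ℕ → Bidual A}
    (hrad : ∀ i, Ξ i ∈ Ring.jacobson (Bidual A)) (hnorm : ∀ i, ‖Ξ i‖ ≤ 1) (hf : f ∅ 1 ≠ 0)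
    (hact : ∀ i S, bidualAct (Ξ i) (f S) = if i ∈ S then f (S.erase i) else 0) :
    ∃ Φ ∈ Ring.jacobson (Bidual A), ¬ IsNilpotent Φ := by
  have hsum : Summable fun i => (1 / 2 : ℂ) ^ i • Ξ i :=
    .of_norm_bounded summable_geometric_two fun i => by
      rw [norm_smul, norm_pow, norm_div, norm_one, RCLike.norm_ofNat]
      exact mul_le_of_le_one_right (by positivity) (hnorm i)
  refine ⟨∑' i, (1 / 2 : ℂ) ^ i • Ξ i, tsum_mem (isClosed_jacobson _) fun i => ?_,
    fun ⟨n, hn⟩ => ?_⟩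
  · rw [← smul_one_mul]
    exact Ideal.mul_mem_left _ _ (hrad i)
  · have hlower (S : Finset ℕ) : bidualAct (∑' i, (1 / 2 : ℂ) ^ i • Ξ i) (f S) =
        ∑ i ∈ S, (1 / 2 : ℂ) ^ i • f (S.erase i) := by
      rw [bidualAct_tsum hsum, tsum_eq_sum fun i (hi : i ∉ S) => ?_]
      · exact Finset.sum_congr rfl fun i hi => by rw [bidualAct_smul, hact, if_pos hi]
      · rw [bidualAct_smul, hact, if_neg hi]
        ext
        exact mul_zero _
    have hpow := pow_card_apply_of_bidualAct_eq_sum hlower (Finset.range n)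
    rw [Finset.card_range, hn, zero_apply] at hpow
    refine mul_ne_zero (mul_ne_zero (Nat.cast_ne_zero.mpr n.factorial_ne_zero) ?_) hf hpow.symm
    exact Finset.prod_ne_zero_iff.mpr fun i _ => pow_ne_zero _ (by norm_num)

end Lowering

end Bidual

open EllOne Bidual

section SignProducts

variable {ι G R : Type*} [AddGroup G] [AddCommGroup R] [LinearOrder R]

/-- The functional on `ℓ¹(G)` given by the bounded function `s ↦ ∏ j ∈ S, sign (φ j s)`. -/
def signProd (φ : ι → G →+ R) (S : Finset ι) : StrongDual ℂ (EllOne G) :=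
  ofLInfty ⟨fun s => ∏ j ∈ S, (SignType.sign (φ j s) : ℂ), memℓp_infty ⟨1, by
    rintro _ ⟨s, rfl⟩
    simpa only [norm_prod] using Finset.prod_le_one (fun _ _ => norm_nonneg _)
      fun j _ => norm_signType_cast_le_one _⟩⟩

variable {φ : ι → G →+ R} {S : Finset ι}

theorem signProd_pointMass (s : G) :
    signProd φ S (pointMass s) = ∏ j ∈ S, (SignType.sign (φ j s) : ℂ) :=
  ofLInfty_pointMass _ s

theorem signProd_empty_one : signProd φ ∅ (1 : EllOne G) = 1 := by
  rw [← pointMass_zero, signProd_pointMass, Finset.prod_empty]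

variable {M M' : Bidual (EllOne G)} {e : G} {i : ι}

theorem Bidual.IsPowerMean.bidualAct_signProd_of_forall_eq_zero
    (hM : IsPowerMean (pointMass e) M) (h0 : ∀ j ∈ S, φ j e = 0) :
    bidualAct M (signProd φ S) = signProd φ S := by
  refine dual_ext fun t => ?_
  rw [bidualAct_apply]
  refine hM.apply_eq_of_tendsto (tendsto_const_nhds.congr fun k => ?_)
  rw [dualAct_apply, pointMass_pow, pointMass_mul_pointMass, signProd_pointMass,
    signProd_pointMass]
  exact Finset.prod_congr rfl fun j hj => by simp [h0 j hj]

variable [IsOrderedAddMonoid R] [Archimedean R] [DecidableEq ι]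

theorem Bidual.IsPowerMean.bidualAct_signProd_of_mem
    (hM : IsPowerMean (pointMass e) M) (hi : i ∈ S) (hne : φ i e ≠ 0)
    (h0 : ∀ j ∈ S.erase i, φ j e = 0) :
    bidualAct M (signProd φ S) = (SignType.sign (φ i e) : ℂ) • signProd φ (S.erase i) := by
  refine dual_ext fun t => ?_
  rw [bidualAct_apply]
  refine hM.apply_eq_of_tendsto (tendsto_const_nhds.congr' ?_)
  filter_upwards [eventually_sign_add_nsmul_eq (φ i t) hne] with k hk
  rw [dualAct_apply, pointMass_pow, pointMass_mul_pointMass, signProd_pointMass,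
    ← Finset.mul_prod_erase S _ hi, smul_apply, signProd_pointMass, map_add, map_nsmul, hk,
    smul_eq_mul]
  congr 1
  exact Finset.prod_congr rfl fun j hj => by simp [h0 j hj]

theorem bidualAct_sub_signProd (hM : IsPowerMean (pointMass e) M)
    (hM' : IsPowerMean (pointMass (-e)) M') (hpos : 0 < φ i e) (h0 : ∀ j ≠ i, φ j e = 0)
    (S : Finset ι) :
    bidualAct (M - M') (signProd φ S) =
      if i ∈ S then (2 : ℂ) • signProd φ (S.erase i) else 0 := by
  rw [bidualAct_sub]
  split_ifs with hi
  · have herase (j : ι) (hj : j ∈ S.erase i) : φ j e = 0 := h0 j (Finset.ne_of_mem_erase hj)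
    have hneg : φ i (-e) < 0 := by simpa using hpos
    rw [hM.bidualAct_signProd_of_mem hi hpos.ne' herase,
      hM'.bidualAct_signProd_of_mem hi hneg.ne fun j hj => by simp [herase j hj],
      sign_pos hpos, sign_neg hneg, SignType.coe_one, SignType.coe_neg_one]
    module
  · have hS (j : ι) (hj : j ∈ S) : φ j e = 0 := h0 j (ne_of_mem_of_not_mem hj hi)
    rw [hM.bidualAct_signProd_of_forall_eq_zero hS,
      hM'.bidualAct_signProd_of_forall_eq_zero fun j hj => by simp [hS j hj], sub_self]

end SignProducts

theorem exists_mem_jacobson_bidualAct_signProd {ι G R : Type*} [DecidableEq ι] [AddCommGroup G]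
    [AddCommGroup R] [LinearOrder R] [IsOrderedAddMonoid R] [Archimedean R] {φ : ι → G →+ R}
    {e : G} {i : ι} (hpos : 0 < φ i e) (h0 : ∀ j ≠ i, φ j e = 0) :
    ∃ Ξ ∈ Ring.jacobson (Bidual (EllOne G)), ‖Ξ‖ ≤ 1 ∧ ∀ S : Finset ι,
      bidualAct Ξ (signProd φ S) = if i ∈ S then signProd φ (S.erase i) else 0 := by
  have hpow (s : G) (k : ℕ) : ‖pointMass s ^ k‖ ≤ 1 := by rw [pointMass_pow, norm_pointMass]
  obtain ⟨M, hMnorm, hM⟩ := exists_isPowerMean (hpow e)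
  obtain ⟨M', hMnorm', hM'⟩ := exists_isPowerMean (hpow (-e))
  have hinv : pointMass e * pointMass (-e) = 1 := by
    rw [pointMass_mul_pointMass, add_neg_cancel, pointMass_zero]
  refine ⟨(2⁻¹ : ℂ) • (M - M'), ?_, ?_, fun S => ?_⟩
  · rw [← smul_one_mul]
    exact Ideal.mul_mem_left _ _
      (hM.sub_mem_jacobson hM' (fun f => EllOne.mul_comm _ f) hinv)
  · rw [norm_smul, norm_inv, RCLike.norm_ofNat]
    linarith [norm_sub_le_of_le hMnorm hMnorm']
  · rw [bidualAct_smul, bidualAct_sub_signProd hM hM' hpos h0]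
    split_ifs
    · exact inv_smul_smul₀ two_ne_zero _
    · ext
      exact mul_zero _

end

theorem mainTheorem4_general {G : Type*} [AddCommGroup G]
    (hG : Cardinal.aleph0 ≤ Module.rank ℤ G) :
    ∃ Φ : Bidual (EllOne G), Φ ∈ Ring.jacobson (Bidual (EllOne G)) ∧ ¬ IsNilpotent Φ := by
  obtain ⟨e, he⟩ := exists_nat_linearIndependent_of_aleph0_le_rank hG
  choose φ hφ using fun i : ℕ =>
    exists_addMonoidHom_apply_eq_of_linearIndependent he (Pi.single i (1 : ℚ))
  choose Ξ hrad hnorm hact using fun i : ℕ =>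
    exists_mem_jacobson_bidualAct_signProd (φ := φ) (e := e i) (i := i) (by simp [hφ])
      fun j hj => by simp [hφ, hj.symm]
  exact Bidual.exists_mem_jacobson_not_isNilpotent hrad hnorm (by simp [signProd_empty_one]) hact

theorem mainTheorem4 :
    ∃ Φ : Bidual (EllOne (ℕ →₀ ℤ)),
      Φ ∈ Ring.jacobson (Bidual (EllOne (ℕ →₀ ℤ))) ∧ ¬ IsNilpotent Φ :=
  mainTheorem4_general (by simp)
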